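/- Identify operators on a qubit $\mathcal H=\mathbb C^2$ with $2\times2$ complex matrices. A quantum channel is a linear, completely positive, trace-preserving map $\Psi:\mathcal L(\mathcal H)\to\mathcal L(\mathcal H)$; it is unital if $\Psi(I)=I$, and entanglement breaking if $(\mathrm{id}\otimes\Psi)(\rho)$ is separable (a convex combination of product states) for every density operator $\rho$ on $\mathcal H\otimes\mathcal H$. Let $\mathcal{UE}$ be the set of all unital entanglement-breaking channels, and let $J_\Psi=(\mathrm{id}\otimes\Psi)\big(\sum_{i,j=0}^{1}|i\rangle\langle j|\otimes|i\rangle\langle j|\big)$. For a density operator $\tau$ on $\mathcal H\otimes\mathcal H$, let $N(\tau)$ be the real $3\times3$ matrix with entries $N(\tau)_{ij}=\operatorname{tr}[\tau(\sigma_i\otimes\sigma_j)]$, where $\sigma_1,\sigma_2,\sigma_3$ are the Pauli matrices. Then, for every density operator $\tau$ on $\mathcal H\otimes\mathcal H$, the maximum $$C(\tau,\mathcal{UE})=\max_{\Psi\in\mathcal{UE}}\operatorname{tr}[\tau J_\Psi]$$ is attained and satisfies $$C(\tau,\mathcal{UE})\le\tfrac12\left(1+\|N(\tau)\|\right),$$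 where $\|A\|=\max_{\|\mathbf x\|=1}\|A\mathbf x\|$ is the matrix norm induced by the Euclidean norm on $\mathbb R^3$. -/

import Mathlib

open scoped Kronecker Matrix ComplexOrder

namespace QubitChannel

noncomputable section

/-- Linear operators on the qubit Hilbert space `ℂ²`, as matrices in the standard basis. -/
abbrev Op : Type := Matrix (Fin 2) (Fin 2) ℂ

/-- Linear operators on the two-qubit Hilbert space `ℂ² ⊗ ℂ²`. -/
abbrev Op2 : Type := Matrix (Fin 2 × Fin 2) (Fin 2 × Fin 2) ℂ

/-- A density operator (quantum state): a positive operator of trace one. -/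
def IsDensity {n : Type*} [Fintype n] (ρ : Matrix n n ℂ) : Prop :=
  ρ.PosSemidef ∧ ρ.trace = 1

/-- The map `id ⊗ Ψ` on operators on `ℂᵏ ⊗ ℂ²`: `Ψ` is applied to each `2 × 2` block. -/
def idTensor {k : Type*} (Ψ : Op →ₗ[ℂ] Op) (M : Matrix (k × Fin 2) (k × Fin 2) ℂ) :
    Matrix (k × Fin 2) (k × Fin 2) ℂ :=
  Matrix.of fun p q => Ψ (Matrix.of fun i j => M (p.1, i) (q.1, j)) p.2 q.2

/-- `id ⊗ Ψ` acts on simple tensors as it should. -/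
theorem idTensor_kronecker {k : Type*} (Ψ : Op →ₗ[ℂ] Op) (A : Matrix k k ℂ) (B : Op) :
    idTensor Ψ (A ⊗ₖ B) = A ⊗ₖ Ψ B := by
  ext ⟨a, b⟩ ⟨a', b'⟩
  have h : (Matrix.of fun i j => (A ⊗ₖ B) (a, i) (a', j) : Op) = A a a' • B := by
    ext i j
    simp [Matrix.kroneckerMap_apply]
  simp only [idTensor, Matrix.of_apply, Matrix.kroneckerMap_apply]
  simp only [Matrix.kroneckerMap_apply] at h
  rw [h, map_smul]
  simp

/-- Additivity of `id ⊗ Ψ`. -/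
theorem idTensor_add {k : Type*} (Ψ : Op →ₗ[ℂ] Op) (M N : Matrix (k × Fin 2) (k × Fin 2) ℂ) :
    idTensor Ψ (M + N) = idTensor Ψ M + idTensor Ψ N := by
  ext p q
  have h : (Matrix.of fun i j => (M + N) (p.1, i) (q.1, j) : Op)
      = (Matrix.of fun i j => M (p.1, i) (q.1, j))
        + (Matrix.of fun i j => N (p.1, i) (q.1, j)) := rfl
  simp only [idTensor, Matrix.of_apply] at h ⊢
  rw [h, map_add]
  rfl

/-- Complete positivity: `id ⊗ Ψ` is positive for every finite-dimensional ancilla `ℂᵏ`. -/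
def IsCompletelyPositive (Ψ : Op →ₗ[ℂ] Op) : Prop :=
  ∀ (k : ℕ) (M : Matrix (Fin k × Fin 2) (Fin k × Fin 2) ℂ),
    M.PosSemidef → (idTensor Ψ M).PosSemidef

/-- A qubit channel: a linear, completely positive and trace preserving map. -/
def IsChannel (Ψ : Op →ₗ[ℂ] Op) : Prop :=
  IsCompletelyPositive Ψ ∧ ∀ A : Op, (Ψ A).trace = A.trace

/-- Separable two-qubit states: convex combinations of product states. -/
def IsSeparable (ρ : Op2) : Prop :=
  ρ ∈ convexHull ℝ {σ : Op2 | ∃ A B : Op, IsDensity A ∧ IsDensity B ∧ σ = A ⊗ₖ B}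

/-- `Ψ` is entanglement breaking: `(id ⊗ Ψ)(ρ)` is separable for every state `ρ` on `ℂ² ⊗ ℂ²`. -/
def IsEntanglementBreaking (Ψ : Op →ₗ[ℂ] Op) : Prop :=
  ∀ ρ : Op2, IsDensity ρ → IsSeparable (idTensor Ψ ρ)

/-- The set of all unital entanglement breaking qubit channels. -/
def UE : Set (Op →ₗ[ℂ] Op) :=
  {Ψ | IsChannel Ψ ∧ Ψ 1 = 1 ∧ IsEntanglementBreaking Ψ}

/-- The unnormalized maximally entangled state `∑ i j, |i⟩⟨j| ⊗ |i⟩⟨j|`. -/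
def maxEntangled : Op2 :=
  ∑ i : Fin 2, ∑ j : Fin 2, Matrix.single i j (1 : ℂ) ⊗ₖ Matrix.single i j (1 : ℂ)

/-- The Choi operator `J_Ψ = (id ⊗ Ψ)(∑ i j, |i⟩⟨j| ⊗ |i⟩⟨j|)`. -/
def choi (Ψ : Op →ₗ[ℂ] Op) : Op2 := idTensor Ψ maxEntangled

/-- `tr[τ J_Ψ]` as a real number; for a state `τ` and a channel `Ψ` the trace is real, see
`ofReal_value`. -/
def value (τ : Op2) (Ψ : Op →ₗ[ℂ] Op) : ℝ := (τ * choi Ψ).trace.re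

/-- `C(τ, X)`, the maximum (supremum) of `tr[τ J_Ψ]` over `Ψ` in the class `X`. -/
def C (τ : Op2) (X : Set (Op →ₗ[ℂ] Op)) : ℝ := sSup (value τ '' X)

/-- The Pauli matrices `σ₁`, `σ₂`, `σ₃` (indexed from `0`). -/
def pauli : Fin 3 → Op :=
  ![!![0, 1; 1, 0], !![0, -Complex.I; Complex.I, 0], !![1, 0; 0, -1]]

/-- The correlation matrix `N(τ)_{ij} = tr[τ (σᵢ ⊗ σⱼ)]`; for a state `τ` these traces are real,
see `ofReal_corr`. -/
def corr (τ : Op2) : Matrix (Fin 3) (Fin 3) ℝ :=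
  Matrix.of fun i j => (τ * (pauli i ⊗ₖ pauli j)).trace.re

/-- The operator norm induced by the Euclidean norm on `ℝ³`. -/
def opNorm (A : Matrix (Fin 3) (Fin 3) ℝ) : ℝ :=
  ‖Matrix.toEuclideanCLM (n := Fin 3) (𝕜 := ℝ) A‖

theorem ofReal_re_trace_mul {n : Type*} [Fintype n] {A B : Matrix n n ℂ}
    (hA : A.IsHermitian) (hB : B.IsHermitian) :
    (((A * B).trace.re : ℝ) : ℂ) = (A * B).trace := by
  apply Complex.conj_eq_iff_re.mp
  have h : star (A * B).trace = (A * B).trace := by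
    rw [← Matrix.trace_conjTranspose, Matrix.conjTranspose_mul, hA.eq, hB.eq,
      Matrix.trace_mul_comm]
  exact h

theorem maxEntangled_eq :
    maxEntangled = Matrix.vecMulVec (fun p : Fin 2 × Fin 2 => if p.1 = p.2 then (1 : ℂ) else 0)
      (star fun p : Fin 2 × Fin 2 => if p.1 = p.2 then (1 : ℂ) else 0) := by
  ext ⟨a, b⟩ ⟨c, d⟩
  fin_cases a <;> fin_cases b <;> fin_cases c <;> fin_cases d <;>
    simp [maxEntangled, Matrix.vecMulVec_apply, Fin.sum_univ_two,
      Matrix.add_apply]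

theorem ofReal_value {τ : Op2} (hτ : IsDensity τ) {Ψ : Op →ₗ[ℂ] Op} (hΨ : IsChannel Ψ) :
    ((value τ Ψ : ℝ) : ℂ) = (τ * choi Ψ).trace := by
  refine ofReal_re_trace_mul hτ.1.1 (hΨ.1 2 _ ?_).1
  rw [maxEntangled_eq]
  exact Matrix.posSemidef_vecMulVec_self_star _

theorem isHermitian_pauli (i : Fin 3) : (pauli i).IsHermitian := by
  ext a b
  fin_cases i <;> fin_cases a <;> fin_cases b <;> simp [pauli]

theorem ofReal_corr {τ : Op2} (hτ : IsDensity τ) (i j : Fin 3) :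
    ((corr τ i j : ℝ) : ℂ) = (τ * (pauli i ⊗ₖ pauli j)).trace := by
  refine ofReal_re_trace_mul hτ.1.1 ?_
  rw [Matrix.IsHermitian, Matrix.conjTranspose_kronecker, (isHermitian_pauli i).eq,
    (isHermitian_pauli j).eq]

end

end QubitChannel

/-! For `Ψ` in `UE`, half the Choi operator is `id ⊗ Ψ` applied to the maximally entangled state,
hence separable. Trace preservation makes its first marginal `I/2`, unitality its second, so its
Pauli expansion has no local terms, and tr[τJ] = ½(1 + Σ N(τ)ᵢⱼ N(J/2)ᵢⱼ) (`value_eq`). The sum is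
linear in J/2, so over separable states it suffices to bound it on product states. There it equals
⟨a, N(τ)b⟩ for Bloch vectors of norm at most 1, hence is at most ‖N(τ)‖ (`IsSeparable.sum_corr_le`).
The maximum is attained because the Choi operators of `UE` form a compact set
(`isCompact_preimage_ofChoi_UE`), nonempty by `depolarizing_mem_UE`. -/

namespace QubitChannel

open scoped Kronecker Matrix ComplexOrder

/-! ### Compactness of convex hulls in finite dimension -/

section ConvexHull

variable {E : Type*} [AddCommGroup E] [Module ℝ E] [FiniteDimensional ℝ E]

/-- Carathéodory's theorem as a parametrization of the convex hull. -/
theorem convexHull_eq_biUnion_image_stdSimplex (s : Set E) :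
    convexHull ℝ s = ⋃ n ∈ Finset.range (Module.finrank ℝ E + 2),
      (fun p : (Fin n → ℝ) × (Fin n → E) => ∑ i, p.1 i • p.2 i) ''
        (stdSimplex ℝ (Fin n) ×ˢ Set.univ.pi fun _ => s) := by
  ext x
  simp only [Set.mem_iUnion, exists_prop, Finset.mem_range]
  constructor
  · intro hx
    obtain ⟨ι, _, z, w, hz, hind, hw, hw1, rfl⟩ := eq_pos_convex_span_of_mem_convexHull hx
    refine ⟨Fintype.card ι, ?_, (w ∘ (Fintype.equivFin ι).symm, z ∘ (Fintype.equivFin ι).symm),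
      ⟨⟨fun i => (hw _).le, ?_⟩, fun i _ => hz ⟨_, rfl⟩⟩, ?_⟩
    · have h1 := hind.card_le_finrank_succ
      have h2 := Submodule.finrank_le (vectorSpan ℝ (Set.range z))
      omega
    · rw [← hw1]
      exact Equiv.sum_comp (Fintype.equivFin ι).symm w
    · exact Equiv.sum_comp (Fintype.equivFin ι).symm fun i => w i • z i
  · rintro ⟨n, -, ⟨w, z⟩, ⟨hw, hz⟩, rfl⟩
    exact (convex_convexHull ℝ s).sum_mem (fun i _ => hw.1 i) hw.2
      fun i _ => subset_convexHull ℝ s (hz i trivial)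

/-- Carathéodory bounds the number of points needed, so the hull is a finite union of continuous
images of compact sets. -/
theorem isCompact_convexHull [TopologicalSpace E] [ContinuousAdd E] [ContinuousSMul ℝ E]
    {s : Set E} (hs : IsCompact s) : IsCompact (convexHull ℝ s) := by
  rw [convexHull_eq_biUnion_image_stdSimplex]
  refine Finset.isCompact_biUnion _ fun n _ => IsCompact.image ?_ (by fun_prop)
  exact (isCompact_stdSimplex ℝ (Fin n)).prod (isCompact_univ_pi fun _ => hs)

end ConvexHull

/-! ### Compactness of the sets of density operators and separable states -/

section Density

/-- This is nonnegativity of the determinant. -/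
theorem IsDensity.normSq_le {A : Op} (hA : IsDensity A) :
    Complex.normSq (A 0 1) ≤ (A 0 0).re * (A 1 1).re := by
  have h := (Complex.le_def.1 hA.1.det_nonneg).1
  have h10 : A 1 0 = star (A 0 1) := (hA.1.1.apply 1 0).symm
  have h0 := (Complex.le_def.1 (hA.1.diag_nonneg (i := 0))).2
  rw [Matrix.det_fin_two, h10] at h
  simp [← h0, Complex.normSq_apply] at h ⊢
  linarith

theorem IsDensity.re_add_re {A : Op} (hA : IsDensity A) : (A 0 0).re + (A 1 1).re = 1 := by
  have h := congrArg Complex.re hA.2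
  simpa [Matrix.trace_fin_two] using h

theorem IsDensity.norm_apply_le {A : Op} (hA : IsDensity A) (i j : Fin 2) : ‖A i j‖ ≤ 1 := by
  have h := hA.normSq_le
  have h1 := hA.re_add_re
  have d (k : Fin 2) := Complex.le_def.1 (hA.1.diag_nonneg (i := k))
  have d0 := (d 0).1
  have d1 := (d 1).1
  simp only [Complex.zero_re] at d0 d1
  have hd (k : Fin 2) : ‖A k k‖ = (A k k).re :=
    (Complex.re_eq_norm.2 hA.1.diag_nonneg).symm
  have h01 : ‖A 0 1‖ ≤ 1 := by
    rw [← sq_le_one_iff₀ (norm_nonneg _), ← Complex.normSq_eq_norm_sq]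
    nlinarith
  have h10 : ‖A 1 0‖ = ‖A 0 1‖ := by rw [← hA.1.1.apply 1 0, norm_star]
  fin_cases i <;> fin_cases j
  · exact (hd 0).trans_le (by linarith)
  · exact h01
  · exact h10.trans_le h01
  · exact (hd 1).trans_le (by linarith)

theorem isClosed_setOf_posSemidef {n : Type*} [Fintype n] :
    IsClosed {M : Matrix n n ℂ | M.PosSemidef} := by
  simp only [Matrix.posSemidef_iff_dotProduct_mulVec, Matrix.IsHermitian, Set.ofPred_and,
    Set.ofPred_forall]
  refine (isClosed_eq (by fun_prop) (by fun_prop)).inter (isClosed_iInter fun x => ?_)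
  exact isClosed_le continuous_const (by fun_prop)

theorem isCompact_setOf_isDensity : IsCompact {A : Op | IsDensity A} := by
  refine IsCompact.of_isClosed_subset
    (isCompact_univ_pi fun _ : Fin 2 => isCompact_univ_pi fun _ : Fin 2 =>
      isCompact_closedBall (0 : ℂ) 1)
    (isClosed_setOf_posSemidef.inter (isClosed_eq (by fun_prop) (by fun_prop))) ?_
  intro A hA i _ j _
  simpa using hA.norm_apply_le i j

theorem continuous_kronecker :
    Continuous fun p : Op × Op => (p.1 ⊗ₖ p.2 : Op2) := by
  refine continuous_matrix fun i j => ?_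
  simp only [Matrix.kroneckerMap_apply]
  fun_prop

theorem isCompact_setOf_isSeparable : IsCompact {σ : Op2 | IsSeparable σ} := by
  refine isCompact_convexHull ?_
  convert (isCompact_setOf_isDensity.prod isCompact_setOf_isDensity).image continuous_kronecker
  ext σ
  simp only [Set.mem_ofPred_eq, Set.mem_image, Set.mem_prod, Prod.exists]
  exact exists₂_congr fun A B => by rw [and_assoc, eq_comm (a := σ)]

end Density

end QubitChannel

namespace QubitChannel

open scoped Kronecker Matrix ComplexOrder

/-! ### Marginals and separability of the Choi operator -/

section Choi

theorem choi_apply (Ψ : Op →ₗ[ℂ] Op) (p q : Fin 2 × Fin 2) :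
    choi Ψ p q = Ψ (Matrix.single p.1 q.1 1) p.2 q.2 := by
  have h : (Matrix.of fun i j => maxEntangled (p.1, i) (q.1, j) : Op)
      = Matrix.single p.1 q.1 1 := by
    ext i j
    rw [maxEntangled_eq]
    simp [Matrix.vecMulVec_apply, Matrix.single_apply, ite_and]
    grind
  rw [choi, idTensor, Matrix.of_apply, h]

theorem sum_choi_right {Ψ : Op →ₗ[ℂ] Op} (hΨ : IsChannel Ψ) (a a' : Fin 2) :
    choi Ψ (a, 0) (a', 0) + choi Ψ (a, 1) (a', 1) = if a = a' then 1 else 0 := by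
  have h := hΨ.2 (Matrix.single a a' 1)
  rw [Matrix.trace_fin_two, Matrix.trace_fin_two] at h
  simp only [choi_apply, h]
  fin_cases a <;> fin_cases a' <;> simp

theorem sum_choi_left {Ψ : Op →ₗ[ℂ] Op} (hΨ : Ψ 1 = 1) (b b' : Fin 2) :
    choi Ψ (0, b) (0, b') + choi Ψ (1, b) (1, b') = if b = b' then 1 else 0 := by
  have h : (Matrix.single 0 0 1 + Matrix.single 1 1 1 : Op) = 1 := by
    ext i j
    fin_cases i <;> fin_cases j <;> simp
  simp only [choi_apply]
  rw [← Matrix.add_apply, ← map_add, h, hΨ, Matrix.one_apply]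

theorem isDensity_half_maxEntangled : IsDensity ((1 / 2 : ℂ) • maxEntangled) := by
  constructor
  · rw [maxEntangled_eq]
    exact (Matrix.posSemidef_vecMulVec_self_star _).smul (by norm_num [Complex.le_def])
  · rw [maxEntangled_eq, Matrix.trace_smul, Matrix.trace]
    simp [Fintype.sum_prod_type, Matrix.vecMulVec_apply]

theorem idTensor_smul {k : Type*} (Ψ : Op →ₗ[ℂ] Op) (c : ℂ)
    (M : Matrix (k × Fin 2) (k × Fin 2) ℂ) : idTensor Ψ (c • M) = c • idTensor Ψ M := by
  ext p q
  have h : (Matrix.of fun i j => (c • M) (p.1, i) (q.1, j) : Op)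
      = c • (Matrix.of fun i j => M (p.1, i) (q.1, j)) := rfl
  simp only [idTensor, Matrix.of_apply, Matrix.smul_apply] at h ⊢
  rw [h, map_smul]
  rfl

theorem IsEntanglementBreaking.isSeparable_half_choi {Ψ : Op →ₗ[ℂ] Op}
    (hΨ : IsEntanglementBreaking Ψ) : IsSeparable ((1 / 2 : ℂ) • choi Ψ) := by
  rw [choi, ← idTensor_smul]
  exact hΨ _ isDensity_half_maxEntangled

end Choi

/-! ### Bloch vectors, correlation matrices and the upper bound -/

section Bloch

noncomputable section

/-- The Bloch vector of an operator on the qubit. -/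
def bloch (A : Op) : EuclideanSpace ℝ (Fin 3) :=
  WithLp.toLp 2 fun i => (A * pauli i).trace.re

end

/-- The squared norm is (tr A)² − 4 det A, with trace 1 and nonnegative determinant. -/
theorem IsDensity.norm_bloch_le {A : Op} (hA : IsDensity A) : ‖bloch A‖ ≤ 1 := by
  have h := hA.normSq_le
  have h1 := hA.re_add_re
  have h10 : A 1 0 = star (A 0 1) := (hA.1.1.apply 1 0).symm
  rw [← sq_le_one_iff₀ (norm_nonneg _), EuclideanSpace.norm_sq_eq, Fin.sum_univ_three]
  simp only [bloch, pauli, Matrix.trace_fin_two, Matrix.mul_apply, Fin.sum_univ_two, h10,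
    Real.norm_eq_abs, sq_abs]
  simp [Complex.normSq_apply] at h ⊢
  nlinarith

/-- The trace factors over the tensor product; the factor from `A` is real, so the real part of the
product splits without any condition on `B`. -/
theorem corr_kronecker {A B : Op} (hA : IsDensity A) (i j : Fin 3) :
    corr (A ⊗ₖ B) i j = bloch A i * bloch B j := by
  have h := ofReal_re_trace_mul hA.1.1 (isHermitian_pauli i)
  rw [corr, Matrix.of_apply, ← Matrix.mul_kronecker_mul, Matrix.trace_kronecker, ← h,
    Complex.re_ofReal_mul]
  rfl

theorem sum_corr_smul (N : Matrix (Fin 3) (Fin 3) ℝ) (c : ℝ) (σ : Op2) :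
    ∑ i, ∑ j, N i j * corr (c • σ) i j = c • ∑ i, ∑ j, N i j * corr σ i j := by
  simp only [Finset.smul_sum]
  refine Finset.sum_congr rfl fun i _ => Finset.sum_congr rfl fun j _ => ?_
  simp only [corr, Matrix.of_apply, Matrix.smul_mul, Matrix.trace_smul, Complex.smul_re,
    smul_eq_mul]
  ring

theorem sum_corr_add (N : Matrix (Fin 3) (Fin 3) ℝ) (σ ρ : Op2) :
    ∑ i, ∑ j, N i j * corr (σ + ρ) i j
      = ∑ i, ∑ j, N i j * corr σ i j + ∑ i, ∑ j, N i j * corr ρ i j := by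
  simp only [← Finset.sum_add_distrib]
  refine Finset.sum_congr rfl fun i _ => Finset.sum_congr rfl fun j _ => ?_
  simp only [corr, Matrix.of_apply, Matrix.add_mul, Matrix.trace_add, Complex.add_re]
  ring

theorem IsSeparable.sum_corr_le (N : Matrix (Fin 3) (Fin 3) ℝ) {σ : Op2} (hσ : IsSeparable σ) :
    ∑ i, ∑ j, N i j * corr σ i j ≤ opNorm N := by
  have hlin : IsLinearMap ℝ fun σ : Op2 => ∑ i, ∑ j, N i j * corr σ i j :=
    ⟨sum_corr_add N, fun c => sum_corr_smul N c⟩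
  refine convexHull_min ?_ (convex_halfSpace_le hlin (opNorm N)) hσ
  rintro _ ⟨A, B, hA, hB, rfl⟩
  have h : ∑ i, ∑ j, N i j * corr (A ⊗ₖ B) i j
      = inner ℝ (bloch A) (Matrix.toEuclideanCLM (𝕜 := ℝ) N (bloch B)) := by
    rw [Matrix.inner_toEuclideanCLM]
    simp only [corr_kronecker hA, dotProduct, Matrix.mulVec, Finset.mul_sum]
    exact Finset.sum_congr rfl fun i _ => Finset.sum_congr rfl fun j _ => by ring
  refine h.trans_le ((real_inner_le_norm _ _).trans ?_)
  calc _ ≤ 1 * (opNorm N * 1) := by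
        refine mul_le_mul hA.norm_bloch_le ?_ (norm_nonneg _) zero_le_one
        exact (ContinuousLinearMap.le_opNorm _ _).trans
          (mul_le_mul_of_nonneg_left hB.norm_bloch_le (norm_nonneg _))
    _ = opNorm N := by ring

/-- Pauli expansion of `tr[τ J]` when both marginals of `J` are the identity. -/
theorem four_mul_trace_mul (τ J : Op2)
    (hr : ∀ a a', J (a, 0) (a', 0) + J (a, 1) (a', 1) = if a = a' then 1 else 0)
    (hl : ∀ b b', J (0, b) (0, b') + J (1, b) (1, b') = if b = b' then 1 else 0) :
    4 * (τ * J).trace = 2 * τ.trace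
      + ∑ i, ∑ j, (τ * (pauli i ⊗ₖ pauli j)).trace * (J * (pauli i ⊗ₖ pauli j)).trace := by
  -- Seven of the eight marginal conditions eliminate entries of `J`; the remaining one, `hl 1 1`,
  -- follows from them.
  have e1 := eq_sub_of_add_eq' (hr 0 0)
  have e2 := eq_sub_of_add_eq' (hr 0 1)
  have e3 := eq_sub_of_add_eq' (hr 1 0)
  have e4 := eq_sub_of_add_eq' (hl 0 0)
  have e5 := eq_sub_of_add_eq' (hl 0 1)
  have e6 := eq_sub_of_add_eq' (hl 1 0)
  have e7 := eq_sub_of_add_eq' (hr 1 1)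
  simp only [Matrix.trace, Matrix.diag_apply, Matrix.mul_apply, Fintype.sum_prod_type,
    Fin.sum_univ_two, Fin.sum_univ_three, Matrix.kroneckerMap_apply, pauli]
  simp
  simp only [e1, e2, e3, e4, e5, e6, e7]
  simp
  ring_nf
  simp only [Complex.I_sq]
  ring

theorem value_eq {τ : Op2} (hτ : IsDensity τ) {Ψ : Op →ₗ[ℂ] Op} (hΨ : IsChannel Ψ)
    (hu : Ψ 1 = 1) :
    value τ Ψ = (1 / 2) * (1 + ∑ i, ∑ j, corr τ i j * corr ((1 / 2 : ℝ) • choi Ψ) i j) := by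
  have h := congrArg Complex.re
    (four_mul_trace_mul τ (choi Ψ) (sum_choi_right hΨ) (sum_choi_left hu))
  simp only [← ofReal_corr hτ, hτ.2, Complex.add_re, Complex.re_sum, Complex.re_ofReal_mul] at h
  rw [sum_corr_smul, value]
  simp only [corr, Matrix.of_apply, smul_eq_mul] at h ⊢
  norm_num at h
  linarith

theorem value_le {τ : Op2} (hτ : IsDensity τ) {Ψ : Op →ₗ[ℂ] Op} (hΨ : Ψ ∈ UE) :
    value τ Ψ ≤ (1 / 2) * (1 + opNorm (corr τ)) := by
  rw [value_eq hτ hΨ.1 hΨ.2.1]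
  have h : ((1 / 2 : ℝ) • choi Ψ) = (1 / 2 : ℂ) • choi Ψ := by
    ext
    simp
  have := (h ▸ hΨ.2.2.isSeparable_half_choi).sum_corr_le (corr τ)
  linarith

end Bloch

end QubitChannel

namespace QubitChannel

open scoped Kronecker Matrix ComplexOrder

/-! ### Compactness of the set of Choi operators of `UE` -/

noncomputable section

/-- The linear map with a given Choi operator. -/
def ofChoi (J : Op2) : Op →ₗ[ℂ] Op where
  toFun X := Matrix.of fun b b' => ∑ a, ∑ a', X a a' * J (a, b) (a', b')
  map_add' X Y := by
    ext b b'
    simp only [Matrix.of_apply, Matrix.add_apply, add_mul, Finset.sum_add_distrib]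
  map_smul' c X := by
    ext b b'
    simp only [Matrix.of_apply, Matrix.smul_apply, smul_eq_mul, mul_assoc, Finset.mul_sum,
      RingHom.id_apply]

/-- The completely depolarizing channel. -/
def depolarizing : Op →ₗ[ℂ] Op :=
  (Matrix.traceLinearMap (Fin 2) ℂ ℂ).smulRight ((1 / 2 : ℂ) • 1)

end

theorem ofChoi_apply (J : Op2) (X : Op) (b b' : Fin 2) :
    ofChoi J X b b' = ∑ a, ∑ a', X a a' * J (a, b) (a', b') := rfl

theorem ofChoi_choi (Ψ : Op →ₗ[ℂ] Op) : ofChoi (choi Ψ) = Ψ := by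
  refine LinearMap.ext fun X => Matrix.ext fun b b' => ?_
  conv_rhs => rw [Matrix.matrix_eq_sum_single X]
  simp only [ofChoi_apply, choi_apply, map_sum, Matrix.sum_apply]
  refine Finset.sum_congr rfl fun a _ => Finset.sum_congr rfl fun a' _ => ?_
  rw [← mul_one (X a a'), ← smul_eq_mul (X a a') (1 : ℂ), ← Matrix.smul_single, map_smul]
  simp

theorem choi_ofChoi (J : Op2) : choi (ofChoi J) = J := by
  ext p q
  rw [choi_apply, ofChoi_apply, Finset.sum_eq_single p.1 (by simp +contextual [eq_comm])
    (by simp), Finset.sum_eq_single q.1 (by simp +contextual [eq_comm]) (by simp)]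
  simp

theorem continuous_ofChoi_apply (X : Op) : Continuous fun J => ofChoi J X := by
  refine continuous_matrix fun b b' => ?_
  simp only [ofChoi_apply]
  fun_prop

theorem continuous_idTensor_ofChoi {k : Type*} (M : Matrix (k × Fin 2) (k × Fin 2) ℂ) :
    Continuous fun J => idTensor (ofChoi J) M :=
  continuous_matrix fun p q => (continuous_ofChoi_apply _).matrix_elem p.2 q.2

/-- Each defining condition is an intersection, over test operators, of preimages of closed sets
under maps continuous in `J`. -/
theorem isClosed_preimage_ofChoi_UE : IsClosed (ofChoi ⁻¹' UE) := by
  have h1 : IsClosed {J | IsCompletelyPositive (ofChoi J)} := by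
    simp only [IsCompletelyPositive, Set.ofPred_forall]
    exact isClosed_iInter fun k => isClosed_iInter fun M => isClosed_iInter fun _ =>
      isClosed_setOf_posSemidef.preimage (continuous_idTensor_ofChoi M)
  have h2 : IsClosed {J | ∀ A : Op, (ofChoi J A).trace = A.trace} := by
    simp only [Set.ofPred_forall]
    exact isClosed_iInter fun A =>
      isClosed_eq (continuous_ofChoi_apply A).matrix_trace continuous_const
  have h3 : IsClosed {J | ofChoi J 1 = 1} :=
    isClosed_eq (continuous_ofChoi_apply 1) continuous_const
  have h4 : IsClosed {J | IsEntanglementBreaking (ofChoi J)} := by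
    simp only [IsEntanglementBreaking, Set.ofPred_forall]
    exact isClosed_iInter fun ρ => isClosed_iInter fun _ =>
      isCompact_setOf_isSeparable.isClosed.preimage (continuous_idTensor_ofChoi ρ)
  exact (h1.inter h2).inter (h3.inter h4)

/-- Boundedness comes from entanglement breaking: every such `J` is twice a separable state. -/
theorem isCompact_preimage_ofChoi_UE : IsCompact (ofChoi ⁻¹' UE) := by
  refine (isCompact_setOf_isSeparable.image (continuous_const_smul (2 : ℂ))).of_isClosed_subset
    isClosed_preimage_ofChoi_UE fun J hJ => ⟨(1 / 2 : ℂ) • J, ?_, ?_⟩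
  · have h := hJ.2.2.isSeparable_half_choi
    rwa [choi_ofChoi] at h
  · simp [smul_smul]

theorem isCompact_image_value_UE (τ : Op2) : IsCompact (value τ '' UE) := by
  have h : value τ '' UE = (fun J => (τ * J).trace.re) '' (ofChoi ⁻¹' UE) := by
    ext x
    constructor
    · rintro ⟨Ψ, hΨ, rfl⟩
      exact ⟨choi Ψ, by rwa [Set.mem_preimage, ofChoi_choi], rfl⟩
    · rintro ⟨J, hJ, rfl⟩
      exact ⟨ofChoi J, hJ, by rw [value, choi_ofChoi]⟩
  rw [h]
  exact isCompact_preimage_ofChoi_UE.image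
    (Complex.continuous_re.comp (continuous_const.matrix_mul continuous_id).matrix_trace)

/-! ### Nonemptiness of `UE` -/

section Depolarizing

theorem depolarizing_apply (X : Op) : depolarizing X = X.trace • (1 / 2 : ℂ) • 1 := rfl

theorem isDensity_half_one : IsDensity ((1 / 2 : ℂ) • 1 : Op) := by
  refine ⟨Matrix.PosSemidef.one.smul (by norm_num [Complex.le_def]), ?_⟩
  simp

theorem idTensor_depolarizing {k : Type*} (M : Matrix (k × Fin 2) (k × Fin 2) ℂ) :
    idTensor depolarizing M
      = (∑ b, M.submatrix (fun a => (a, b)) fun a => (a, b)) ⊗ₖ ((1 / 2 : ℂ) • 1 : Op) := by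
  ext p q
  simp only [idTensor, Matrix.of_apply, depolarizing_apply, Matrix.smul_apply, smul_eq_mul,
    Matrix.kroneckerMap_apply, Matrix.sum_apply, Matrix.submatrix_apply]
  rfl

theorem posSemidef_partialTrace {k : Type*} {M : Matrix (k × Fin 2) (k × Fin 2) ℂ}
    (hM : M.PosSemidef) : (∑ b, M.submatrix (fun a => (a, b)) fun a => (a, b)).PosSemidef :=
  Matrix.posSemidef_sum _ fun _ _ => hM.submatrix _

theorem depolarizing_mem_UE : depolarizing ∈ UE := by
  refine ⟨⟨fun k M hM => ?_, fun A => ?_⟩, ?_, fun ρ hρ => ?_⟩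
  · rw [idTensor_depolarizing]
    exact (posSemidef_partialTrace hM).kronecker isDensity_half_one.1
  · rw [depolarizing_apply, Matrix.trace_smul, isDensity_half_one.2, smul_eq_mul, mul_one]
  · rw [depolarizing_apply]
    simp [smul_smul]
  -- The output is already a product state, the reduced state of `ρ` tensored with `I/2`.
  · refine subset_convexHull ℝ _ ⟨_, _, ⟨posSemidef_partialTrace hρ.1, ?_⟩, isDensity_half_one,
      idTensor_depolarizing ρ⟩
    rw [← hρ.2]
    simp [Matrix.trace, Fintype.sum_prod_type]

end Depolarizing

end QubitChannel

/-- For every two-qubit state `τ`, the maximum of `tr[τ J_Ψ]` over unital entanglement breaking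
qubit channels is attained, and it is at most `(1 + ‖N(τ)‖) / 2`. -/
theorem mainTheorem1 (τ : QubitChannel.Op2) (hτ : QubitChannel.IsDensity τ) :
    IsGreatest (QubitChannel.value τ '' QubitChannel.UE) (QubitChannel.C τ QubitChannel.UE) ∧
      QubitChannel.C τ QubitChannel.UE ≤
        (1 / 2) * (1 + QubitChannel.opNorm (QubitChannel.corr τ)) := by
  have hne : (QubitChannel.value τ '' QubitChannel.UE).Nonempty :=
    ⟨_, _, QubitChannel.depolarizing_mem_UE, rfl⟩
  refine ⟨(QubitChannel.isCompact_image_value_UE τ).isGreatest_sSup hne, csSup_le hne ?_⟩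
  rintro _ ⟨Ψ, hΨ, rfl⟩
  exact QubitChannel.value_le hτ hΨ
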